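/- Let $\Phi$ be a homogeneous Poisson point process on $\mathbb{R}^2$ with intensity $\lambda>0$, regarded as a random element of the space of simple, locally finite configurations of points of $\mathbb{R}^2$ with the vague topology (the coarsest topology that makes $\varphi\mapsto\sum_{x\in\varphi}f(x)$ continuous for every continuous $f:\mathbb{R}^2\to\mathbb{R}$ of compact support) and its Borel $\sigma$-algebra. Two different atoms $x,y$ of a configuration $\varphi$ are in mutually nearest neighbor relation (MNNR) with respect to $\varphi$ if $y$ minimizes $\|x-z\|$ over $z\in\varphi\setminus\{x\}$ and $x$ minimizes $\|y-z\|$ over $z\in\varphi\setminus\{y\}$. Let $\varphi^{(2)}$ be the set of atoms of $\varphi$ that are in MNNR with another atom of $\varphi$, and let $\varphi^{(1)}=\varphi\setminus\varphi^{(2)}$ be the set of the remaining (single) atoms. For a Borel set $A\subset\mathbb{R}^2$ put $\Phi^{(i)}_A=(\Phi\cap A)^{(i)}$, so that MNNR is considered only among the atoms inside $A$. Let $(A_n)$ be Borel subsets of $\mathbb{R}^2$ that fill up the plane, in the sense that every point of $\mathbb{R}^2$ lies in $A_n$ for all sufficiently large $n$ (for example, $A_n$ the ball of radius $n$ around the origin;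 more generally, any increasing sequence with union $\mathbb{R}^2$, or any sequence such that every ball $B(0,m)$ is contained in $A_n$ for all sufficiently large $n$). Then, for $i=1,2$, $\Phi^{(i)}_{A_n}$ and $\Phi^{(i)}$ are random configurations (measurable up to almost sure equality), and $\Phi^{(i)}_{A_n}$ converges in distribution to $\Phi^{(i)}$ as $n\to\infty$, that is, $\mathbb{E}[F(\Phi^{(i)}_{A_n})]\to\mathbb{E}[F(\Phi^{(i)})]$ for every bounded continuous real function $F$ on the configuration space. -/

import Mathlib

open MeasureTheory ProbabilityTheory Filter Topology
open scoped NNReal ENNReal CompactlySupported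

/-- The Euclidean plane. -/
abbrev Plane : Type := EuclideanSpace ℝ (Fin 2)

/-- A simple, locally finite configuration of points of the plane: a set of points of which every
compact set contains only finitely many. -/
@[ext]
structure Configuration where
  /-- The set of atoms. -/
  atoms : Set Plane
  finite_inter : ∀ K : Set Plane, IsCompact K → (atoms ∩ K).Finite

namespace Configuration

/-- The atoms of `φ` that lie in `S` (for a window `S`, this is `φ` observed inside `S`). -/
def restrict (φ : Configuration) (S : Set Plane) : Configuration where
  atoms := φ.atoms ∩ S
  finite_inter K hK := (φ.finite_inter K hK).subset fun _ hx => ⟨hx.1.1, hx.2⟩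

/-- The number of atoms of `φ` in `B`. It is used for bounded sets `B` only, which contain finitely
many atoms. -/
noncomputable def count (φ : Configuration) (B : Set Plane) : ℕ := (φ.atoms ∩ B).ncard

/-- The sum of `f` over the atoms of `φ`, that is, the integral of `f` with respect to the counting
measure of `φ`. For `f` of compact support only finitely many terms are nonzero. -/
noncomputable def sum (φ : Configuration) (f : C_c(Plane, ℝ)) : ℝ := ∑ᶠ x ∈ φ.atoms, f x

/-- The vague topology: the coarsest topology that makes `φ ↦ ∑ x ∈ φ, f x` continuous for every
continuous function `f` of compact support. -/
noncomputable instance : TopologicalSpace Configuration :=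
  ⨅ f : C_c(Plane, ℝ), TopologicalSpace.induced (fun φ => φ.sum f) inferInstance

/-- The Borel σ-algebra of the vague topology. -/
noncomputable instance : MeasurableSpace Configuration := borel Configuration

instance : BorelSpace Configuration := ⟨rfl⟩

/-- `x` is in nearest neighbor relation with `y` with respect to `φ`: `x` and `y` are different
atoms of `φ`, and `y` minimizes the distance to `x` among all atoms of `φ` other than `x`. -/
def NNR (φ : Configuration) (x y : Plane) : Prop :=
  x ∈ φ.atoms ∧ y ∈ φ.atoms ∧ y ≠ x ∧ ∀ z ∈ φ.atoms, z ≠ x → dist x y ≤ dist x z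

/-- `x` and `y` are in mutually nearest neighbor relation with respect to `φ`. -/
def MNNR (φ : Configuration) (x y : Plane) : Prop := φ.NNR x y ∧ φ.NNR y x

/-- The single atoms of `φ`: the atoms in mutually nearest neighbor relation with no other atom. -/
def singles (φ : Configuration) : Configuration :=
  φ.restrict {x | ∀ y ∈ φ.atoms, ¬ φ.MNNR x y}

/-- The atoms of `φ` that are in mutually nearest neighbor relation with another atom of `φ`. -/
def pairs (φ : Configuration) : Configuration :=
  φ.restrict {x | ∃ y ∈ φ.atoms, φ.MNNR x y}

end Configuration

/-- `Φ` is a (homogeneous) Poisson point process on the plane with intensity `lam` under `P`: it is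
a random configuration, the number of its atoms in a bounded Borel set `B` is Poisson distributed
with mean `lam` times the area of `B`, and the numbers of its atoms in finitely many pairwise
disjoint bounded Borel sets are independent. -/
structure IsPoissonPointProcess {Ω : Type*} [MeasurableSpace Ω] (P : Measure Ω)
    (Φ : Ω → Configuration) (lam : ℝ≥0) : Prop where
  measurable : Measurable Φ
  map_count : ∀ B : Set Plane, MeasurableSet B → Bornology.IsBounded B →
    P.map (fun ω => (Φ ω).count B) = poissonMeasure (lam * (volume B).toNNReal)
  iIndepFun_count : ∀ (k : ℕ) (B : Fin k → Set Plane), (∀ i, MeasurableSet (B i)) →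
    (∀ i, Bornology.IsBounded (B i)) → Pairwise (fun i j => Disjoint (B i) (B j)) →
    iIndepFun (fun i ω => (Φ ω).count (B i)) P

/-! The convergence already holds for every fixed configuration `φ`. If `z₀` is some atom other than
`x`, the nearest neighbors of `x` are decided by the finitely many atoms in the closed ball around
`x` through `z₀`. Once the window contains these atoms and `x`, the relations starting at `x` no
longer change. As `x` has finitely many nearest neighbors, its mutual relations stabilize too
(`eventually_MNNR_restrict_iff`). A test function sees only finitely many atoms, so its sums are
eventually constant, which is vague convergence. Dominated convergence turns this into convergence
in distribution.

The remaining work is measurability. Countably many sums generate the vague topology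
(`exists_countable_family`), so measurability into the Borel σ-algebra can be tested on sums, hence
on atom counts. Pairs and singles are thinnings by a jointly measurable rule
(`measurable_restrict`). -/

namespace Configuration

/-! ### Sums of test functions and vague convergence -/

section Sum

/-- The sum over a configuration is a finite sum over the atoms in any compact set that contains
the support. -/
lemma sum_eq_finset_sum (φ : Configuration) (f : C_c(Plane, ℝ)) {K : Set Plane}
    (hK : IsCompact K) (hf : ∀ x ∉ K, f x = 0) :
    φ.sum f = ∑ x ∈ (φ.finite_inter K hK).toFinset, f x := by
  classical
  rw [sum, ← finsum_mem_coe_finset, ← finsum_mem_inter_support,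
    ← finsum_mem_inter_support (s := ((φ.finite_inter K hK).toFinset : Set Plane))]
  congr! 4 with x
  ext x
  simp only [Set.Finite.coe_toFinset, Set.mem_inter_iff, Function.mem_support]
  constructor
  · rintro ⟨h1, h2⟩
    exact ⟨⟨h1, by_contra fun h => h2 (hf x h)⟩, h2⟩
  · rintro ⟨h1, h2⟩
    exact ⟨h1.1, h2⟩

/-- The error is dominated by a multiple of a compactly supported `h`, since a constant bound could
sum to infinity over the atoms. -/
lemma sum_sub_sum_le (φ : Configuration) (f g h : C_c(Plane, ℝ)) {c : ℝ}
    (hfg : ∀ x, |f x - g x| ≤ c * h x) : |φ.sum f - φ.sum g| ≤ c * φ.sum h := by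
  have hK : IsCompact (tsupport f ∪ tsupport g ∪ tsupport h) :=
    (f.hasCompactSupport.isCompact.union g.hasCompactSupport).union h.hasCompactSupport
  rw [φ.sum_eq_finset_sum f hK, φ.sum_eq_finset_sum g hK, φ.sum_eq_finset_sum h hK,
    ← Finset.sum_sub_distrib, Finset.mul_sum]
  · exact (Finset.abs_sum_le_sum_abs _ _).trans (Finset.sum_le_sum fun x _ => hfg x)
  all_goals
    intro x hx
    refine image_eq_zero_of_notMem_tsupport fun h => hx ?_
    simp [h]

lemma continuous_sum (f : C_c(Plane, ℝ)) : Continuous fun φ : Configuration => φ.sum f :=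
  continuous_iff_le_induced.2 (iInf_le _ f)

lemma tendsto_iff {ι : Type*} {l : Filter ι} {u : ι → Configuration} {φ : Configuration} :
    Tendsto u l (𝓝 φ) ↔ ∀ f : C_c(Plane, ℝ), Tendsto (fun i => (u i).sum f) l (𝓝 (φ.sum f)) := by
  rw [nhds_iInf, tendsto_iInf]
  simp only [nhds_induced, tendsto_comap_iff]
  rfl

end Sum

/-! ### Countable generation of the vague topology -/

section Borel

/-- A continuous function of compact support, with values in the unit interval, that is one on the
closed ball of radius `m` around the origin. -/
lemma exists_cutoff (m : ℕ) : ∃ h : C_c(Plane, ℝ),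
    (∀ x ∈ Metric.closedBall (0 : Plane) m, h x = 1) ∧ ∀ x, 0 ≤ h x := by
  obtain ⟨h, h1, -, h2, h3⟩ := exists_continuous_one_zero_of_isCompact
    (isCompact_closedBall (0 : Plane) m) isClosed_empty (Set.disjoint_empty _)
  exact ⟨⟨h, h2⟩, fun x hx => h1 hx, fun x => (h3 x).1⟩

/-- The product of a continuous function and a continuous function of compact support. -/
def cutoffMul (h : C_c(Plane, ℝ)) (g : C(Plane, ℝ)) : C_c(Plane, ℝ) where
  toContinuousMap := h.toContinuousMap * g
  hasCompactSupport' := h.hasCompactSupport.mul_right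

/-- Countably many sums already determine the vague topology. -/
lemma exists_countable_family : ∃ D : Set C_c(Plane, ℝ), D.Countable ∧
    (inferInstance : TopologicalSpace Configuration) =
      ⨅ d : D, TopologicalSpace.induced (fun φ => φ.sum (d : C_c(Plane, ℝ))) inferInstance := by
  choose h h1 h0 using exists_cutoff
  let g : ℕ → C(Plane, ℝ) := TopologicalSpace.denseSeq C(Plane, ℝ)
  let D : Set C_c(Plane, ℝ) :=
    Set.range h ∪ Set.range fun p : ℕ × ℕ => cutoffMul (h p.1) (g p.2)
  refine ⟨D, (Set.countable_range _).union (Set.countable_range _), le_antisymm ?_ ?_⟩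
  · exact le_iInf fun d => iInf_le _ _
  refine le_iInf fun f => ?_
  rw [← continuous_iff_le_induced]
  let τ : TopologicalSpace Configuration :=
    ⨅ d : D, TopologicalSpace.induced (fun φ => φ.sum (d : C_c(Plane, ℝ))) inferInstance
  have hD : ∀ d ∈ D, Continuous fun φ : Configuration => φ.sum d := fun d hd =>
    continuous_iff_le_induced.2 (iInf_le _ (⟨d, hd⟩ : D))
  obtain ⟨m, hm⟩ : ∃ m : ℕ, tsupport f ⊆ Metric.closedBall 0 m := by
    obtain ⟨r, hr⟩ := f.hasCompactSupport.isCompact.isBounded.subset_closedBall 0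
    obtain ⟨m, hm⟩ := exists_nat_ge r
    exact ⟨m, hr.trans (Metric.closedBall_subset_closedBall hm)⟩
  have hhf : ∀ x, f x = h m x * f x := by
    intro x
    by_cases hx : x ∈ tsupport f
    · rw [h1 m x (hm hx), one_mul]
    · rw [image_eq_zero_of_notMem_tsupport hx, mul_zero]
  -- Since `f = h m * f`, approximating `f` on the support of `h m` by some `g n` and multiplying by
  -- `h m` gives an error of at most `ε * h m`.
  have approx : ∀ ε > 0, ∃ d ∈ D, ∀ φ : Configuration,
      |φ.sum f - φ.sum d| ≤ ε * φ.sum (h m) := by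
    intro ε hε
    have hU : {k : C(Plane, ℝ) | ∀ x ∈ tsupport (h m), dist (f.toContinuousMap x) (k x) < ε}
        ∈ 𝓝 f.toContinuousMap := by
      have := (ContinuousMap.tendsto_iff_forall_isCompact_tendstoUniformlyOn
        (F := fun k : C(Plane, ℝ) => k) (p := 𝓝 f.toContinuousMap) (f := f.toContinuousMap)).1
        tendsto_id (tsupport (h m)) (h m).hasCompactSupport
      exact Metric.tendstoUniformlyOn_iff.1 this ε hε
    obtain ⟨n, hn⟩ :=
      (TopologicalSpace.denseRange_denseSeq C(Plane, ℝ)).exists_mem_open isOpen_interior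
        ⟨_, mem_interior_iff_mem_nhds.2 hU⟩
    have hk := interior_subset hn
    refine ⟨cutoffMul (h m) (g n), Or.inr ⟨(m, n), rfl⟩, fun φ => sum_sub_sum_le _ _ _ _ ?_⟩
    intro x
    have : cutoffMul (h m) (g n) x = h m x * g n x := rfl
    rw [this, hhf x, ← mul_sub, abs_mul, abs_of_nonneg (h0 m x), mul_comm]
    by_cases hx : x ∈ tsupport (h m)
    · exact mul_le_mul_of_nonneg_right (hk x hx).le (h0 m x)
    · rw [image_eq_zero_of_notMem_tsupport hx, mul_zero, mul_zero]
  rw [continuous_iff_continuousAt]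
  intro φ₀
  refine continuousAt_of_locally_uniform_approx_of_continuousAt fun u hu => ?_
  obtain ⟨ε, hε, hεu⟩ := Metric.mem_uniformity_dist.1 hu
  have hpos : 0 < |φ₀.sum (h m)| + 1 := by positivity
  obtain ⟨d, hd, hfd⟩ := approx (ε / (2 * (|φ₀.sum (h m)| + 1))) (by positivity)
  -- On this neighborhood of `φ₀` the sum of `h m` is bounded, so the approximation of `f` is
  -- uniform there.
  refine ⟨{φ | φ.sum (h m) < |φ₀.sum (h m)| + 1}, ?_, _, (hD d hd).continuousAt, ?_⟩
  · exact ((hD _ (Or.inl ⟨m, rfl⟩)).isOpen_preimage _ isOpen_Iio).mem_nhds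
      (show φ₀.sum (h m) < _ from (le_abs_self _).trans_lt (lt_add_one _))
  · intro φ hφ
    apply hεu
    rw [Real.dist_eq]
    refine (hfd φ).trans_lt ?_
    calc _ ≤ ε / (2 * (|φ₀.sum (h m)| + 1)) * (|φ₀.sum (h m)| + 1) :=
          mul_le_mul_of_nonneg_left (le_of_lt hφ) (by positivity)
      _ = ε / 2 := by field_simp
      _ < ε := half_lt_self hε

/-- A map into the space of configurations is Borel measurable as soon as all its sums are. -/
lemma measurable_of_measurable_sum {α : Type*} [MeasurableSpace α] {X : α → Configuration}
    (hX : ∀ f : C_c(Plane, ℝ), Measurable fun a => (X a).sum f) : Measurable X := by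
  obtain ⟨D, hD, hτ⟩ := exists_countable_family
  have : Countable D := hD
  let e : Configuration → D → ℝ := fun φ d => φ.sum (d : C_c(Plane, ℝ))
  have he : (inferInstance : TopologicalSpace Configuration) =
      TopologicalSpace.induced e inferInstance := by
    rw [hτ, Pi.topologicalSpace, induced_iInf]
    simp only [induced_compose]
    rfl
  have hb : (inferInstance : MeasurableSpace Configuration) =
      MeasurableSpace.comap e inferInstance := by
    rw [(inferInstance : BorelSpace (D → ℝ)).measurable_eq, ← borel_comap, ← he]
    rfl
  have hX' : @Measurable _ _ _ (MeasurableSpace.comap e inferInstance) X :=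
    measurable_comap_iff.2 (measurable_pi_lambda _ fun d => hX d)
  rwa [← hb] at hX'

end Borel

/-! ### Counting measures and measurability of thinnings -/

section ToMeasure

/-- The counting measure of a configuration. -/
noncomputable def toMeasure (φ : Configuration) : Measure Plane :=
  Measure.count.restrict φ.atoms

lemma countable_atoms (φ : Configuration) : φ.atoms.Countable := by
  refine (Set.countable_iUnion fun m : ℕ =>
    (φ.finite_inter _ (isCompact_closedBall (0 : Plane) m)).countable).mono fun x hx => ?_
  obtain ⟨m, hm⟩ := exists_nat_ge (dist x 0)
  exact Set.mem_iUnion.2 ⟨m, hx, hm⟩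

lemma measurableSet_atoms (φ : Configuration) : MeasurableSet φ.atoms :=
  φ.countable_atoms.measurableSet

lemma toMeasure_apply (φ : Configuration) {B : Set Plane} (hB : MeasurableSet B) :
    φ.toMeasure B = Measure.count (B ∩ φ.atoms) :=
  Measure.restrict_apply hB

lemma toMeasure_eq_zero_iff (φ : Configuration) {B : Set Plane} (hB : MeasurableSet B) :
    φ.toMeasure B = 0 ↔ ∀ x ∈ φ.atoms, x ∉ B := by
  rw [toMeasure_apply φ hB, Measure.count_eq_zero_iff, Set.eq_empty_iff_forall_notMem]
  exact ⟨fun h x hx hxB => h x ⟨hxB, hx⟩, fun h x hx => h x hx.2 hx.1⟩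

lemma toMeasure_isCompact_lt_top (φ : Configuration) {K : Set Plane} (hK : IsCompact K) :
    φ.toMeasure K < ∞ := by
  rw [toMeasure_apply φ hK.measurableSet, Measure.count_apply_lt_top, Set.inter_comm]
  exact φ.finite_inter K hK

instance (φ : Configuration) : IsFiniteMeasureOnCompacts φ.toMeasure :=
  ⟨fun _ hK => φ.toMeasure_isCompact_lt_top hK⟩

lemma integrable_toMeasure (φ : Configuration) (f : C_c(Plane, ℝ)) :
    Integrable f φ.toMeasure :=
  f.continuous.integrable_of_hasCompactSupport f.hasCompactSupport

lemma integral_toMeasure (φ : Configuration) (f : C_c(Plane, ℝ)) :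
    ∫ x, f x ∂φ.toMeasure = φ.sum f := by
  have hT := φ.finite_inter _ f.hasCompactSupport
  have h1 : ∫ x in φ.atoms, f x ∂(Measure.count : Measure Plane) =
      ∫ x in φ.atoms ∩ tsupport f, f x ∂(Measure.count : Measure Plane) :=
    setIntegral_eq_of_subset_of_forall_sdiff_eq_zero φ.measurableSet_atoms Set.inter_subset_left
      fun x hx => image_eq_zero_of_notMem_tsupport fun h => hx.2 ⟨hx.1, h⟩
  have h2 : ∫ x in (hT.toFinset : Set Plane), f x ∂(Measure.count : Measure Plane) =
      ∑ x ∈ hT.toFinset, f x := by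
    rw [setIntegral_finset]
    · simp [Measure.real]
    · rw [hT.coe_toFinset]
      exact IntegrableOn.mono_set (φ.integrable_toMeasure f) Set.inter_subset_left
  rw [hT.coe_toFinset] at h2
  rw [toMeasure, h1, h2]
  exact (φ.sum_eq_finset_sum f f.hasCompactSupport
    fun x hx => image_eq_zero_of_notMem_tsupport hx).symm

/-- The continuous functions of compact support that decrease to the indicator of a compact set. -/
noncomputable def thickenedBump (K : Set Plane) (hK : IsCompact K) (n : ℕ) : C_c(Plane, ℝ) where
  toFun x := thickenedIndicator (Nat.one_div_pos_of_nat (α := ℝ) (n := n)) K x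
  continuous_toFun := by fun_prop
  hasCompactSupport' := by
    refine HasCompactSupport.of_support_subset_isCompact
      (hK.cthickening (r := 1 / ((n : ℝ) + 1))) fun x hx => ?_
    by_contra h
    refine hx ?_
    exact congrArg NNReal.toReal
      (thickenedIndicator_zero _ _ fun h' => h (Metric.thickening_subset_cthickening _ _ h'))

lemma tendsto_thickenedBump {K : Set Plane} (hK : IsCompact K) (x : Plane) :
    Tendsto (fun n => thickenedBump K hK n x) atTop (𝓝 (K.indicator 1 x)) := by
  have := thickenedIndicator_tendsto_indicator_closure
    (fun n : ℕ => Nat.one_div_pos_of_nat (α := ℝ) (n := n))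
    tendsto_one_div_add_atTop_nhds_zero_nat K
  have h := (NNReal.continuous_coe.tendsto _).comp (tendsto_pi_nhds.1 this x)
  rw [hK.isClosed.closure_eq] at h
  have h1 : K.indicator (1 : Plane → ℝ) x = (K.indicator (fun _ => (1 : ℝ≥0)) x : ℝ≥0) := by
    by_cases hx : x ∈ K <;> simp [hx]
  rw [h1]
  exact h

lemma measurable_toMeasure_isCompact {K : Set Plane} (hK : IsCompact K) :
    Measurable fun φ : Configuration => φ.toMeasure K := by
  have key : ∀ φ : Configuration,
      Tendsto (fun n => φ.sum (thickenedBump K hK n)) atTop (𝓝 (φ.toMeasure.real K)) := by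
    intro φ
    have : φ.toMeasure.real K = ∫ x, K.indicator 1 x ∂φ.toMeasure :=
      (integral_indicator_one hK.measurableSet).symm
    simp_rw [this, ← integral_toMeasure]
    refine tendsto_integral_of_dominated_convergence (thickenedBump K hK 0)
      (fun n => (φ.integrable_toMeasure _).aestronglyMeasurable) (φ.integrable_toMeasure _)
      (fun n => Eventually.of_forall fun x => ?_)
      (Eventually.of_forall fun x => tendsto_thickenedBump hK x)
    have h0 : 0 ≤ thickenedBump K hK n x := NNReal.coe_nonneg _
    rw [Real.norm_of_nonneg h0]
    refine NNReal.coe_le_coe.2 (thickenedIndicator_mono _ _ ?_ K x)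
    exact Nat.one_div_le_one_div (Nat.zero_le n)
  have hm : Measurable fun φ : Configuration => φ.toMeasure.real K :=
    measurable_of_tendsto_metrizable (fun n => (continuous_sum _).measurable)
      (tendsto_pi_nhds.2 key)
  have h : ∀ φ : Configuration, φ.toMeasure K = ENNReal.ofReal (φ.toMeasure.real K) := fun φ =>
    (ofReal_measureReal (φ.toMeasure_isCompact_lt_top hK).ne).symm
  simp_rw [h]
  exact hm.ennreal_ofReal

instance (φ : Configuration) (m : ℕ) :
    IsFiniteMeasure (φ.toMeasure.restrict (Metric.closedBall 0 m)) :=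
  ⟨by simpa using φ.toMeasure_isCompact_lt_top (isCompact_closedBall _ _)⟩

/-- Restricting to a ball makes the measures finite, so the π-system of closed sets suffices, and
closed sets meet the ball in compact sets. -/
lemma measurable_toMeasure_restrict_closedBall (m : ℕ) :
    Measurable fun φ : Configuration => φ.toMeasure.restrict (Metric.closedBall 0 m) := by
  refine .measure_of_isPiSystem
    (BorelSpace.measurable_eq.trans borel_eq_generateFrom_isClosed) isPiSystem_isClosed ?_ ?_
  · intro s hs
    simp_rw [Measure.restrict_apply (IsClosed.measurableSet hs)]
    exact measurable_toMeasure_isCompact ((isCompact_closedBall _ _).inter_left hs)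
  · simp_rw [Measure.restrict_apply_univ]
    exact measurable_toMeasure_isCompact (isCompact_closedBall _ _)

lemma toMeasure_eq_iSup (φ : Configuration) (B : Set Plane) :
    φ.toMeasure B = ⨆ m : ℕ, φ.toMeasure.restrict (Metric.closedBall 0 m) B := by
  simp_rw [Measure.restrict_apply' Metric.isClosed_closedBall.measurableSet]
  rw [← Monotone.measure_iUnion, ← Set.inter_iUnion, Metric.iUnion_closedBall_nat, Set.inter_univ]
  intro m n hmn
  exact Set.inter_subset_inter_right _ (Metric.closedBall_subset_closedBall (by exact_mod_cast hmn))

/-- The number of atoms of a random configuration in a section of a measurable set is measurable. -/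
lemma measurable_toMeasure_prodMk_left {α : Type*} [MeasurableSpace α] {X : α → Configuration}
    (hX : Measurable X) {E : Set (α × Plane)} (hE : MeasurableSet E) :
    Measurable fun a => (X a).toMeasure (Prod.mk a ⁻¹' E) := by
  simp_rw [toMeasure_eq_iSup]
  refine .iSup fun m => ?_
  let κ : Kernel α Plane := ⟨_, (measurable_toMeasure_restrict_closedBall m).comp hX⟩
  exact Kernel.measurable_kernel_prodMk_left_of_finite (κ := κ) hE fun a =>
    inferInstanceAs (IsFiniteMeasure ((X a).toMeasure.restrict _))

/-- A map into the space of configurations is measurable if its numbers of atoms in Borel sets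
are. -/
lemma measurable_of_measurable_toMeasure {α : Type*} [MeasurableSpace α] {X : α → Configuration}
    (hX : ∀ B, MeasurableSet B → Measurable fun a => (X a).toMeasure B) : Measurable X := by
  refine measurable_of_measurable_sum fun f => ?_
  have hm : Measurable fun a => (X a).toMeasure := Measure.measurable_of_measurable_coe _ hX
  simp_rw [← integral_toMeasure]
  simp_rw [fun a => integral_eq_lintegral_pos_part_sub_lintegral_neg_part
    ((X a).integrable_toMeasure f)]
  have hf : Measurable f := f.continuous.measurable
  exact ((Measure.measurable_lintegral (hf.ennreal_ofReal)).comp hm).ennreal_toReal.sub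
    ((Measure.measurable_lintegral (hf.neg.ennreal_ofReal)).comp hm).ennreal_toReal

lemma toMeasure_restrict (φ : Configuration) (S : Set Plane) {B : Set Plane}
    (hB : MeasurableSet B) :
    (φ.restrict S).toMeasure B = Measure.count (B ∩ (φ.atoms ∩ S)) :=
  toMeasure_apply _ hB

/-- A thinning by a rule that is jointly measurable in the configuration and the atom is
measurable. -/
lemma measurable_restrict {α : Type*} [MeasurableSpace α] {X : α → Configuration}
    (hX : Measurable X) {S : α → Set Plane} {E : Set (α × Plane)} (hE : MeasurableSet E)
    (hS : ∀ a, ∀ x ∈ (X a).atoms, x ∈ S a ↔ (a, x) ∈ E) :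
    Measurable fun a => (X a).restrict (S a) := by
  refine measurable_of_measurable_toMeasure fun B hB => ?_
  convert measurable_toMeasure_prodMk_left hX (hE.inter (measurable_snd hB)) using 2 with a
  rw [toMeasure_restrict _ _ hB,
    toMeasure_apply _ (measurable_prodMk_left (hE.inter (measurable_snd hB)))]
  congr 1
  ext x
  simp only [Set.mem_inter_iff, Set.mem_preimage]
  constructor
  · rintro ⟨h1, h2, h3⟩
    exact ⟨⟨(hS a x h2).1 h3, h1⟩, h2⟩
  · rintro ⟨⟨h1, h2⟩, h3⟩
    exact ⟨h2, h3, (hS a x h3).2 h1⟩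

end ToMeasure

/-! ### Measurability of pairs and singles -/

section Neighbors

/-- The existence of an atom with a jointly measurable property is a measurable event. -/
lemma measurableSet_exists_atom {α : Type*} [MeasurableSpace α] {X : α → Configuration}
    (hX : Measurable X) {E : Set (α × Plane)} (hE : MeasurableSet E) :
    MeasurableSet {a | ∃ x ∈ (X a).atoms, (a, x) ∈ E} := by
  have : {a | ∃ x ∈ (X a).atoms, (a, x) ∈ E} =
      (fun a => (X a).toMeasure (Prod.mk a ⁻¹' E)) ⁻¹' {0}ᶜ := by
    ext a
    simp only [Set.mem_preimage, Set.mem_compl_iff, Set.mem_singleton_iff,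
      toMeasure_eq_zero_iff _ (measurable_prodMk_left hE)]
    simp
  rw [this]
  exact measurable_toMeasure_prodMk_left hX hE (measurableSet_singleton 0).compl

/-- For random points `u`, `v` it is a measurable event that `v ≠ u` and no atom other than `u` is
closer to `u` than `v`. -/
lemma measurableSet_nearest {α : Type*} [MeasurableSpace α] {X : α → Configuration}
    (hX : Measurable X) {u v : α → Plane} (hu : Measurable u) (hv : Measurable v) :
    MeasurableSet {a | v a ≠ u a ∧
      ∀ z ∈ (X a).atoms, z ≠ u a → dist (u a) (v a) ≤ dist (u a) z} := by
  have hE : MeasurableSet {p : α × Plane |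
      p.2 ≠ u p.1 ∧ dist (u p.1) p.2 < dist (u p.1) (v p.1)} := by
    have hu' : Measurable fun p : α × Plane => u p.1 := hu.comp measurable_fst
    have hv' : Measurable fun p : α × Plane => v p.1 := hv.comp measurable_fst
    exact (measurableSet_eq_fun measurable_snd hu').compl.inter
      (measurableSet_lt (hu'.dist measurable_snd) (hu'.dist hv'))
  -- Minimality fails exactly when some atom other than `u a` is strictly closer.
  convert (measurableSet_eq_fun hv hu).compl.inter (measurableSet_exists_atom hX hE).compl using 1
  ext a
  simp

/-- Membership of `p.2` in the configuration is left out, so that both halves are instances of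
`measurableSet_nearest`; thinning only tests atoms anyway. -/
lemma measurableSet_MNNR : MeasurableSet {p : Configuration × Plane |
    ∃ y ∈ p.1.atoms, (y ≠ p.2 ∧ ∀ z ∈ p.1.atoms, z ≠ p.2 → dist p.2 y ≤ dist p.2 z) ∧
      (p.2 ≠ y ∧ ∀ z ∈ p.1.atoms, z ≠ y → dist y p.2 ≤ dist y z)} := by
  refine measurableSet_exists_atom (X := fun p : Configuration × Plane => p.1) measurable_fst
    (E := {q | (q.2 ≠ q.1.2 ∧ ∀ z ∈ q.1.1.atoms, z ≠ q.1.2 → dist q.1.2 q.2 ≤ dist q.1.2 z) ∧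
      (q.1.2 ≠ q.2 ∧ ∀ z ∈ q.1.1.atoms, z ≠ q.2 → dist q.2 q.1.2 ≤ dist q.2 z)}) ?_
  exact (measurableSet_nearest measurable_fst.fst measurable_fst.snd measurable_snd).inter
    (measurableSet_nearest measurable_fst.fst measurable_snd measurable_fst.snd)

lemma exists_MNNR_iff (φ : Configuration) {x : Plane} (hx : x ∈ φ.atoms) :
    (∃ y ∈ φ.atoms, φ.MNNR x y) ↔
    ∃ y ∈ φ.atoms, (y ≠ x ∧ ∀ z ∈ φ.atoms, z ≠ x → dist x y ≤ dist x z) ∧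
      (x ≠ y ∧ ∀ z ∈ φ.atoms, z ≠ y → dist y x ≤ dist y z) := by
  refine exists_congr fun y => and_congr_right fun hy => ?_
  simp [MNNR, NNR, hx, hy]

lemma measurable_pairs : Measurable pairs :=
  measurable_restrict measurable_id measurableSet_MNNR fun φ _ hx => φ.exists_MNNR_iff hx

lemma measurable_singles : Measurable singles := by
  refine measurable_restrict measurable_id measurableSet_MNNR.compl fun φ x hx => ?_
  rw [Set.mem_compl_iff]
  refine Iff.trans ?_ (φ.exists_MNNR_iff hx).not
  simp

lemma measurable_restrict_const {A : Set Plane} (hA : MeasurableSet A) :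
    Measurable fun φ : Configuration => φ.restrict A :=
  measurable_restrict measurable_id (measurable_snd hA) fun _ _ _ => Iff.rfl

end Neighbors

/-! ### Stabilization in growing windows -/

section Windows

lemma sum_congr {φ ψ : Configuration} {f : C_c(Plane, ℝ)}
    (h : φ.atoms ∩ tsupport f = ψ.atoms ∩ tsupport f) : φ.sum f = ψ.sum f := by
  rw [φ.sum_eq_finset_sum f f.hasCompactSupport fun x hx => image_eq_zero_of_notMem_tsupport hx,
    ψ.sum_eq_finset_sum f f.hasCompactSupport fun x hx => image_eq_zero_of_notMem_tsupport hx]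
  congr 1
  ext x
  simp only [Set.Finite.mem_toFinset, h]

lemma finite_setOf_NNR (φ : Configuration) (x : Plane) : {y | φ.NNR x y}.Finite := by
  rcases Set.eq_empty_or_nonempty {y | φ.NNR x y} with h | ⟨z, hz⟩
  · simp [h]
  · refine (φ.finite_inter _ (isCompact_closedBall x (dist x z))).subset fun y hy => ⟨hy.2.1, ?_⟩
    rw [Metric.mem_closedBall, dist_comm]
    exact hy.2.2.2 z hz.2.1 hz.2.2.1

variable {ι : Type*} {l : Filter ι} {A : ι → Set Plane}

lemma eventually_NNR_restrict_iff (φ : Configuration) (hA : ∀ x : Plane, ∀ᶠ n in l, x ∈ A n)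
    (x : Plane) : ∀ᶠ n in l, ∀ y, (φ.restrict (A n)).NNR x y ↔ φ.NNR x y := by
  by_cases h : ∃ z ∈ φ.atoms, z ≠ x
  · obtain ⟨z₀, hz₀, hz₀x⟩ := h
    have hF := φ.finite_inter _ (isCompact_closedBall x (dist x z₀))
    filter_upwards [(hF.eventually_all).2 fun y _ => hA y, hA z₀, hA x] with n hn hnz hnx y
    constructor
    · rintro ⟨hx, hy, hyx, hmin⟩
      refine ⟨hx.1, hy.1, hyx, fun z hz hzx => ?_⟩
      -- Atoms in the ball are in the window and compete there; those outside are farther away than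
      -- `z₀`, which is itself in the window.
      by_cases hzF : dist x z ≤ dist x z₀
      · exact hmin z ⟨hz, hn z ⟨hz, by rwa [Metric.mem_closedBall, dist_comm]⟩⟩ hzx
      · exact (hmin z₀ ⟨hz₀, hnz⟩ hz₀x).trans (not_le.1 hzF).le
    · rintro ⟨hx, hy, hyx, hmin⟩
      refine ⟨⟨hx, hnx⟩, ⟨hy, hn y ⟨hy, ?_⟩⟩, hyx, fun z hz => hmin z hz.1⟩
      rw [Metric.mem_closedBall, dist_comm]
      exact hmin z₀ hz₀ hz₀x
  · push Not at h
    exact Eventually.of_forall fun n y =>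
      ⟨fun hy => absurd (h y hy.2.1.1) hy.2.2.1, fun hy => absurd (h y hy.2.1) hy.2.2.1⟩

lemma eventually_MNNR_restrict_iff (φ : Configuration) (hA : ∀ x : Plane, ∀ᶠ n in l, x ∈ A n)
    (x : Plane) : ∀ᶠ n in l, ∀ y, (φ.restrict (A n)).MNNR x y ↔ φ.MNNR x y := by
  filter_upwards [φ.eventually_NNR_restrict_iff hA x, (φ.finite_setOf_NNR x).eventually_all.2
    fun y _ => φ.eventually_NNR_restrict_iff hA y] with n hn hn' y
  rw [MNNR, MNNR, hn y]
  exact and_congr_right fun hy => hn' y hy x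

lemma mem_pairs_iff (φ : Configuration) (x : Plane) :
    x ∈ φ.pairs.atoms ↔ x ∈ φ.atoms ∧ ∃ y, φ.MNNR x y :=
  and_congr_right fun _ => ⟨fun ⟨y, _, h⟩ => ⟨y, h⟩, fun ⟨y, h⟩ => ⟨y, h.1.2.1, h⟩⟩

lemma mem_singles_iff (φ : Configuration) (x : Plane) :
    x ∈ φ.singles.atoms ↔ x ∈ φ.atoms ∧ ∀ y, ¬ φ.MNNR x y :=
  and_congr_right fun _ => ⟨fun h y hy => h y hy.1.2.1 hy, fun h y _ => h y⟩

/-- Configurations converge vaguely if the membership of every point that can be an atom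
stabilizes. -/
lemma tendsto_of_eventually_mem_iff {u : ι → Configuration} {φ ψ : Configuration}
    (hu : ∀ n, (u n).atoms ⊆ φ.atoms) (hψ : ψ.atoms ⊆ φ.atoms)
    (h : ∀ x ∈ φ.atoms, ∀ᶠ n in l, x ∈ (u n).atoms ↔ x ∈ ψ.atoms) : Tendsto u l (𝓝 ψ) := by
  refine tendsto_iff.2 fun f => tendsto_const_nhds.congr' ?_
  filter_upwards [(φ.finite_inter _ f.hasCompactSupport).eventually_all.2 fun x hx => h x hx.1]
    with n hn
  refine sum_congr (Set.ext fun x => ⟨fun hx => ⟨?_, hx.2⟩, fun hx => ⟨?_, hx.2⟩⟩)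
  · exact (hn x ⟨hψ hx.1, hx.2⟩).2 hx.1
  · exact (hn x ⟨hu n hx.1, hx.2⟩).1 hx.1

lemma tendsto_pairs_restrict (φ : Configuration) (hA : ∀ x : Plane, ∀ᶠ n in l, x ∈ A n) :
    Tendsto (fun n => (φ.restrict (A n)).pairs) l (𝓝 φ.pairs) := by
  refine tendsto_of_eventually_mem_iff (fun n x hx => hx.1.1) (fun x hx => hx.1) fun x hx => ?_
  filter_upwards [hA x, φ.eventually_MNNR_restrict_iff hA x] with n hn hn'
  simp only [mem_pairs_iff, hn']
  exact and_congr_left fun _ => ⟨fun h => h.1, fun h => ⟨h, hn⟩⟩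

lemma tendsto_singles_restrict (φ : Configuration) (hA : ∀ x : Plane, ∀ᶠ n in l, x ∈ A n) :
    Tendsto (fun n => (φ.restrict (A n)).singles) l (𝓝 φ.singles) := by
  refine tendsto_of_eventually_mem_iff (fun n x hx => hx.1.1) (fun x hx => hx.1) fun x hx => ?_
  filter_upwards [hA x, φ.eventually_MNNR_restrict_iff hA x] with n hn hn'
  simp only [mem_singles_iff, hn']
  exact and_congr_left fun _ => ⟨fun h => h.1, fun h => ⟨h, hn⟩⟩

end Windows

end Configuration

/-! ### From pointwise convergence to convergence in distribution -/

/-- Pointwise convergence of measurable maps into any topological space with its Borel sets implies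
convergence in distribution. -/
lemma tendstoInDistribution_of_forall_tendsto {Ω E : Type*} [MeasurableSpace Ω] {P : Measure Ω}
    [IsProbabilityMeasure P] [TopologicalSpace E] [MeasurableSpace E] [OpensMeasurableSpace E]
    {X : ℕ → Ω → E} {Z : Ω → E} (hX : ∀ n, Measurable (X n)) (hZ : Measurable Z)
    (h : ∀ ω, Tendsto (fun n => X n ω) atTop (𝓝 (Z ω))) :
    TendstoInDistribution X atTop Z (fun _ => P) P where
  forall_aemeasurable n := (hX n).aemeasurable
  aemeasurable_limit := hZ.aemeasurable
  tendsto := by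
    refine ProbabilityMeasure.tendsto_iff_forall_integral_tendsto.2 fun F => ?_
    have hF : StronglyMeasurable F := F.continuous.measurable.stronglyMeasurable
    have hmap : ∀ Y : Ω → E, Measurable Y → ∫ x, F x ∂(P.map Y) = ∫ ω, F (Y ω) ∂P :=
      fun Y hY => integral_map hY.aemeasurable hF.aestronglyMeasurable
    simp only [ProbabilityMeasure.coe_mk]
    simp_rw [hmap _ hZ, fun n => hmap _ (hX n)]
    exact tendsto_integral_of_dominated_convergence (fun _ => ‖F‖)
      (fun n => (hF.comp_measurable (hX n)).aestronglyMeasurable) (integrable_const _)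
      (fun n => Eventually.of_forall fun ω => F.norm_coe_le_norm _)
      (Eventually.of_forall fun ω => (F.continuous.tendsto _).comp (h ω))

theorem theorem5 {Ω : Type*} [MeasurableSpace Ω] (P : Measure Ω) [IsProbabilityMeasure P]
    (lam : ℝ≥0) (hlam : 0 < lam) (Φ : Ω → Configuration) (hΦ : IsPoissonPointProcess P Φ lam)
    (A : ℕ → Set Plane) (hA : ∀ n, MeasurableSet (A n))
    (hA_lim : ∀ x : Plane, ∀ᶠ n in atTop, x ∈ A n) :
    TendstoInDistribution (fun n ω => ((Φ ω).restrict (A n)).singles) atTop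
        (fun ω => (Φ ω).singles) (fun _ => P) P ∧
      TendstoInDistribution (fun n ω => ((Φ ω).restrict (A n)).pairs) atTop
        (fun ω => (Φ ω).pairs) (fun _ => P) P := by
  have hm : ∀ n, Measurable fun ω => (Φ ω).restrict (A n) := fun n =>
    (Configuration.measurable_restrict_const (hA n)).comp hΦ.measurable
  exact ⟨tendstoInDistribution_of_forall_tendsto
      (fun n => Configuration.measurable_singles.comp (hm n))
      (Configuration.measurable_singles.comp hΦ.measurable)
      fun ω => (Φ ω).tendsto_singles_restrict hA_lim,
    tendstoInDistribution_of_forall_tendsto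
      (fun n => Configuration.measurable_pairs.comp (hm n))
      (Configuration.measurable_pairs.comp hΦ.measurable)
      fun ω => (Φ ω).tendsto_pairs_restrict hA_lim⟩
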